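/- Let $M$ be a model of Quine's New Foundations (NF), that is, a nonempty structure for the language of set theory satisfying extensionality and comprehension for all stratified formulas with parameters. Let $\mathbf{N}$ be the category whose objects are the sets of $M$ and whose morphisms $A\to B$ are the sets of $M$ that are (graphs of) functions from $A$ to $B$, with the usual identities and composition. Write $\iota``A=\{\{a\}\mid a\in A\}$ and let $T:\mathbf{N}\to\mathbf{N}$ be the functor given by $TA=\iota``A$ on objects and $Tf=\{\langle\{a\},\{b\}\rangle\mid\langle a,b\rangle\in f\}$ on morphisms. Theorem. The functor $T$ is not part of an adjunction, nor a composite of an adjoint pair: 1. $T$ is not a right adjoint (there is no functor $L:\mathbf{N}\to\mathbf{N}$ with $L\dashv T$); 2. $T$ is not a left adjoint (there is no functor $R:\mathbf{N}\to\mathbf{N}$ with $T\dashv R$); 3. there are no category $\mathbf{D}$ and functors $F:\mathbf{N}\to\mathbf{D}$, $G:\mathbf{D}\to\mathbf{N}$ with $F\dashv G$ and $T\cong G\circ F$; 4. there are no category $\mathbf{D}$ and functors $F:\mathbf{D}\to\mathbf{N}$, $G:\mathbf{N}\to\mathbf{D}$ with $F\dashv G$ and $T\cong F\circ G$. Here $\cong$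 is natural isomorphism of functors; in particular $T$ is not equal to such a composite. -/

import Mathlib

open CategoryTheory

universe u v w

namespace NF

/-! ## The language of set theory and stratified formulas -/

/-- The only non-logical symbol: a binary relation symbol for membership. -/
inductive MemRel : ℕ → Type
  | mem : MemRel 2

/-- The first-order language of set theory (equality is a logical symbol). -/
def setLang : FirstOrder.Language.{0, 0} := ⟨fun _ => Empty, MemRel⟩

/-- The type of a term under a typing of the variables; every term of `setLang` is a variable. -/
def termType {β : Type} (σ : β → ℕ) : setLang.Term β → ℕ
  | .var b => σ b
  | .func f _ => Empty.elim f

/-- `StratifiedBy φ σ τ`: the typing `σ` of the free variables and `τ` of the variables indexed by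
`Fin n` extends, by some choice of one type for each quantified variable, to a stratification of
`φ`: in `s = t` both variables have the same type, in `s ∈ t` the type of `t` is one higher. -/
def StratifiedBy {α : Type} :
    {n : ℕ} → setLang.BoundedFormula α n → (α → ℕ) → (Fin n → ℕ) → Prop
  | _, .falsum, _, _ => True
  | _, .equal s t, σ, τ => termType (Sum.elim σ τ) s = termType (Sum.elim σ τ) t
  | _, .rel MemRel.mem ts, σ, τ =>
      termType (Sum.elim σ τ) (ts 0) + 1 = termType (Sum.elim σ τ) (ts 1)
  | _, .imp φ ψ, σ, τ => StratifiedBy φ σ τ ∧ StratifiedBy ψ σ τ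
  | _, .all φ, σ, τ => ∃ k : ℕ, StratifiedBy φ σ (Fin.snoc τ k)

/-! ## Models of NF -/

/-- The membership relation of a structure for the language of set theory. -/
def mem {M : Type u} [setLang.Structure M] (x y : M) : Prop :=
  FirstOrder.Language.Structure.RelMap (L := setLang) (M := M) MemRel.mem ![x, y]

/-- `M` is a model of NF: a nonempty structure satisfying extensionality and, for every stratified
formula `φ(z)` with parameters, the comprehension axiom `∃ y, ∀ z, z ∈ y ↔ φ(z)`. -/
class IsModel (M : Type u) [setLang.Structure M] : Prop where
  nonempty : Nonempty M
  extensionality : ∀ a b : M, (∀ z : M, mem z a ↔ mem z b) → a = b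
  comprehension : ∀ (φ : setLang.BoundedFormula ℕ 1) (σ : ℕ → ℕ) (τ : Fin 1 → ℕ),
    StratifiedBy φ σ τ → ∀ params : ℕ → M, ∃ y : M, ∀ z : M, mem z y ↔ φ.Realize params ![z]

/-! ## Some stratified formulas -/

section Formulas

/-- Weakening of a variable under a quantifier. -/
def lift {n : ℕ} : ℕ ⊕ Fin n → ℕ ⊕ Fin (n + 1) := Sum.map id Fin.castSucc

/-- The most recently quantified variable. -/
def top {n : ℕ} : ℕ ⊕ Fin (n + 1) := Sum.inr (Fin.last n)

/-- The formula `a ∈ b`. -/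
def fMem {n : ℕ} (a b : ℕ ⊕ Fin n) : setLang.BoundedFormula ℕ n :=
  .rel (l := 2) MemRel.mem ![.var a, .var b]

/-- The formula `a = b`. -/
def fEq {n : ℕ} (a b : ℕ ⊕ Fin n) : setLang.BoundedFormula ℕ n :=
  .equal (.var a) (.var b)

/-- The formula `p = {a, b}`. -/
def fUpair {n : ℕ} (p a b : ℕ ⊕ Fin n) : setLang.BoundedFormula ℕ n :=
  ((fMem top (lift p)).iff (fEq top (lift a) ⊔ fEq top (lift b))).all

/-- The formula `p = {{a}, {a, b}}`. -/
def fPair {n : ℕ} (p a b : ℕ ⊕ Fin n) : setLang.BoundedFormula ℕ n :=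
  ((fUpair (lift top) (lift (lift a)) (lift (lift a)) ⊓
    (fUpair top (lift (lift a)) (lift (lift b)) ⊓
      fUpair (lift (lift p)) (lift top) top)).ex).ex

/-- The formula `{{a}, {a, b}} ∈ f`. -/
def fPairMem {n : ℕ} (a b f : ℕ ⊕ Fin n) : setLang.BoundedFormula ℕ n :=
  (fPair top (lift a) (lift b) ⊓ fMem top (lift f)).ex

variable {n : ℕ} {σ : ℕ → ℕ} {τ : Fin n → ℕ}

@[simp] theorem elim_snoc_lift {β : Type*} (s : ℕ → β) (t : Fin n → β) (k : β) (a : ℕ ⊕ Fin n) :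
    Sum.elim s (Fin.snoc t k : Fin (n + 1) → β) (lift a) = Sum.elim s t a := by
  cases a <;> simp [lift]

@[simp] theorem elim_snoc_top {β : Type*} (s : ℕ → β) (t : Fin n → β) (k : β) :
    Sum.elim s (Fin.snoc t k : Fin (n + 1) → β) top = k := by
  simp [top]

theorem strat_not {φ : setLang.BoundedFormula ℕ n} :
    StratifiedBy φ.not σ τ ↔ StratifiedBy φ σ τ := by
  show (StratifiedBy φ σ τ ∧ True) ↔ _
  simp

theorem strat_inf {φ ψ : setLang.BoundedFormula ℕ n} :
    StratifiedBy (φ ⊓ ψ) σ τ ↔ StratifiedBy φ σ τ ∧ StratifiedBy ψ σ τ := by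
  show ((StratifiedBy φ σ τ ∧ (StratifiedBy ψ σ τ ∧ True)) ∧ True) ↔ _
  simp

theorem strat_sup {φ ψ : setLang.BoundedFormula ℕ n} :
    StratifiedBy (φ ⊔ ψ) σ τ ↔ StratifiedBy φ σ τ ∧ StratifiedBy ψ σ τ := by
  show ((StratifiedBy φ σ τ ∧ True) ∧ StratifiedBy ψ σ τ) ↔ _
  simp

theorem strat_iff {φ ψ : setLang.BoundedFormula ℕ n} :
    StratifiedBy (φ.iff ψ) σ τ ↔ StratifiedBy φ σ τ ∧ StratifiedBy ψ σ τ := by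
  rw [FirstOrder.Language.BoundedFormula.iff, strat_inf]
  show ((StratifiedBy φ σ τ ∧ StratifiedBy ψ σ τ) ∧
    (StratifiedBy ψ σ τ ∧ StratifiedBy φ σ τ)) ↔ _
  tauto

theorem strat_all {φ : setLang.BoundedFormula ℕ (n + 1)} :
    StratifiedBy φ.all σ τ ↔ ∃ k : ℕ, StratifiedBy φ σ (Fin.snoc τ k) := Iff.rfl

theorem strat_ex {φ : setLang.BoundedFormula ℕ (n + 1)} :
    StratifiedBy φ.ex σ τ ↔ ∃ k : ℕ, StratifiedBy φ σ (Fin.snoc τ k) := by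
  rw [FirstOrder.Language.BoundedFormula.ex, strat_not, strat_all]
  simp only [strat_not]

theorem strat_mem {a b : ℕ ⊕ Fin n} :
    StratifiedBy (fMem a b) σ τ ↔ Sum.elim σ τ a + 1 = Sum.elim σ τ b := Iff.rfl

theorem strat_eq {a b : ℕ ⊕ Fin n} :
    StratifiedBy (fEq a b) σ τ ↔ Sum.elim σ τ a = Sum.elim σ τ b := Iff.rfl

theorem strat_upair {p a b : ℕ ⊕ Fin n} (h1 : Sum.elim σ τ a + 1 = Sum.elim σ τ p)
    (h2 : Sum.elim σ τ b = Sum.elim σ τ a) : StratifiedBy (fUpair p a b) σ τ := by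
  rw [fUpair, strat_all]
  refine ⟨Sum.elim σ τ a, ?_⟩
  simp [strat_iff, strat_sup, strat_mem, strat_eq, h1, h2]

theorem strat_pair {p a b : ℕ ⊕ Fin n} (h1 : Sum.elim σ τ a + 2 = Sum.elim σ τ p)
    (h2 : Sum.elim σ τ b = Sum.elim σ τ a) : StratifiedBy (fPair p a b) σ τ := by
  rw [fPair, strat_ex]
  refine ⟨Sum.elim σ τ a + 1, ?_⟩
  rw [strat_ex]
  refine ⟨Sum.elim σ τ a + 1, ?_⟩
  rw [strat_inf, strat_inf]
  refine ⟨strat_upair ?_ ?_, strat_upair ?_ ?_, strat_upair ?_ ?_⟩ <;> simp [h2, ← h1]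

theorem strat_pairMem {a b f : ℕ ⊕ Fin n} (h1 : Sum.elim σ τ a + 3 = Sum.elim σ τ f)
    (h2 : Sum.elim σ τ b = Sum.elim σ τ a) : StratifiedBy (fPairMem a b f) σ τ := by
  rw [fPairMem, strat_ex]
  refine ⟨Sum.elim σ τ a + 2, ?_⟩
  rw [strat_inf]
  exact ⟨strat_pair (by simp) (by simp [h2]), by simp [strat_mem, ← h1]⟩

end Formulas

/-! ## Unordered and ordered pairs, sets of singletons -/

section Sets

variable {M : Type u} [setLang.Structure M]

@[simp] theorem realize_mem {n : ℕ} {s : ℕ → M} {t : Fin n → M} {a b : ℕ ⊕ Fin n} :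
    (fMem a b).Realize s t ↔ mem (Sum.elim s t a) (Sum.elim s t b) := by
  show FirstOrder.Language.Structure.RelMap (L := setLang) (M := M) MemRel.mem _ ↔
    FirstOrder.Language.Structure.RelMap (L := setLang) (M := M) MemRel.mem _
  apply iff_of_eq
  congr 1
  funext i
  fin_cases i <;> rfl

@[simp] theorem realize_eq {n : ℕ} {s : ℕ → M} {t : Fin n → M} {a b : ℕ ⊕ Fin n} :
    (fEq a b).Realize s t ↔ Sum.elim s t a = Sum.elim s t b := Iff.rfl

variable [IsModel M]

theorem exists_upair (a b : M) : ∃ p : M, ∀ z : M, mem z p ↔ z = a ∨ z = b := by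
  obtain ⟨y, hy⟩ := IsModel.comprehension (M := M)
    (fEq (.inr 0) (.inl 0) ⊔ fEq (.inr 0) (.inl 1)) (fun _ => 0) (fun _ => 0)
    (strat_sup.2 ⟨rfl, rfl⟩) (fun k => if k = 0 then a else b)
  exact ⟨y, fun z => by simp [hy z]⟩

/-- The unordered pair `{a, b}`. -/
noncomputable def upair (a b : M) : M := (exists_upair a b).choose

theorem mem_upair {a b z : M} : mem z (upair a b) ↔ z = a ∨ z = b :=
  (exists_upair a b).choose_spec z

theorem eq_upair {p a b : M} : p = upair a b ↔ ∀ z : M, mem z p ↔ z = a ∨ z = b := by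
  constructor
  · rintro rfl z
    exact mem_upair
  · intro h
    exact IsModel.extensionality _ _ fun z => (h z).trans mem_upair.symm

/-- The singleton `ι(a) = {a}`. -/
noncomputable def sing (a : M) : M := upair a a

theorem mem_sing {a z : M} : mem z (sing a) ↔ z = a := by
  rw [sing, mem_upair, or_self]

theorem sing_injective {a b : M} (h : sing a = sing b) : a = b :=
  mem_sing.1 (h ▸ mem_sing.2 rfl)

/-- The ordered pair `⟨a, b⟩ = {{a}, {a, b}}`; `a` and `b` receive the same type in it. -/
noncomputable def pair (a b : M) : M := upair (sing a) (upair a b)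

theorem pair_injective {a b c d : M} (h : pair a b = pair c d) : a = c ∧ b = d := by
  have hs : sing a = sing c ∨ sing a = upair c d := by
    rw [← mem_upair]
    exact (show mem (sing a) (pair c d) from h ▸ mem_upair.2 (Or.inl rfl))
  have hac : a = c := by
    rcases hs with e | e
    · exact sing_injective e
    · exact (mem_sing.1 (e ▸ mem_upair.2 (Or.inl rfl) : mem c (sing a))).symm
  subst hac
  refine ⟨rfl, ?_⟩
  have h1 : upair a b = sing a ∨ upair a b = upair a d := by
    rw [← mem_upair]
    exact (show mem (upair a b) (pair a d) from h ▸ mem_upair.2 (Or.inr rfl))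
  have h2 : upair a d = sing a ∨ upair a d = upair a b := by
    rw [← mem_upair]
    exact (show mem (upair a d) (pair a b) from h.symm ▸ mem_upair.2 (Or.inr rfl))
  rcases h1 with e | e
  · have hb : b = a := mem_sing.1 (e ▸ mem_upair.2 (Or.inr rfl) : mem b (sing a))
    rcases h2 with e' | e'
    · exact hb.trans (mem_sing.1 (e' ▸ mem_upair.2 (Or.inr rfl) : mem d (sing a))).symm
    · rw [e] at e'
      exact hb.trans (mem_sing.1 (e' ▸ mem_upair.2 (Or.inr rfl) : mem d (sing a))).symm
  · have hb : b = a ∨ b = d := mem_upair.1 (e ▸ mem_upair.2 (Or.inr rfl))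
    have hd : d = a ∨ d = b := mem_upair.1 (e.symm ▸ mem_upair.2 (Or.inr rfl))
    rcases hb with hb | hb
    · rcases hd with hd | hd
      · rw [hb, hd]
      · exact hd.symm
    · exact hb

@[simp] theorem realize_upair {n : ℕ} {s : ℕ → M} {t : Fin n → M} {p a b : ℕ ⊕ Fin n} :
    (fUpair p a b).Realize s t ↔
      Sum.elim s t p = upair (Sum.elim s t a) (Sum.elim s t b) := by
  rw [fUpair, FirstOrder.Language.BoundedFormula.realize_all, eq_upair]
  simp

@[simp] theorem realize_pair {n : ℕ} {s : ℕ → M} {t : Fin n → M} {p a b : ℕ ⊕ Fin n} :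
    (fPair p a b).Realize s t ↔
      Sum.elim s t p = pair (Sum.elim s t a) (Sum.elim s t b) := by
  rw [fPair]
  simp [pair, sing]

@[simp] theorem realize_pairMem {n : ℕ} {s : ℕ → M} {t : Fin n → M} {a b f : ℕ ⊕ Fin n} :
    (fPairMem a b f).Realize s t ↔
      mem (pair (Sum.elim s t a) (Sum.elim s t b)) (Sum.elim s t f) := by
  rw [fPairMem]
  simp

theorem exists_usc (A : M) : ∃ y : M, ∀ z : M, mem z y ↔ ∃ a : M, mem a A ∧ z = sing a := by
  obtain ⟨y, hy⟩ := IsModel.comprehension (M := M)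
    ((fMem top (lift (.inl 0)) ⊓ fUpair (lift (.inr 0)) top top).ex) (fun _ => 1) (fun _ => 1)
    (by
      rw [strat_ex]
      refine ⟨0, ?_⟩
      rw [strat_inf]
      exact ⟨by simp [strat_mem], strat_upair (by simp) (by simp)⟩) (fun _ => A)
  exact ⟨y, fun z => by
    simp only [hy z,
      FirstOrder.Language.BoundedFormula.realize_ex,
      FirstOrder.Language.BoundedFormula.realize_inf, realize_mem, realize_upair,
      elim_snoc_lift, elim_snoc_top]
    rfl⟩

/-- The set of singletons `ι``A = {{a} | a ∈ A}`. -/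
noncomputable def usc (A : M) : M := (exists_usc A).choose

theorem mem_usc {A z : M} : mem z (usc A) ↔ ∃ a : M, mem a A ∧ z = sing a :=
  (exists_usc A).choose_spec z

/-! ## Functions -/

/-- `f` is (the graph of) a function from `A` to `B`: a set of ordered pairs of elements of `A` and
`B` relating every element of `A` to exactly one element. -/
def IsFun (f A B : M) : Prop :=
  (∀ p : M, mem p f → ∃ x y : M, mem x A ∧ mem y B ∧ p = pair x y) ∧
    ∀ x : M, mem x A → ∃! y : M, mem (pair x y) f

theorem IsFun.mem_of_pair {f A B x y : M} (h : IsFun f A B) (hp : mem (pair x y) f) :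
    mem x A ∧ mem y B := by
  obtain ⟨x', y', hx, hy, e⟩ := h.1 _ hp
  obtain ⟨rfl, rfl⟩ := pair_injective e
  exact ⟨hx, hy⟩

theorem IsFun.ext {f g A B : M} (hf : IsFun f A B) (hg : IsFun g A B)
    (h : ∀ x y : M, mem (pair x y) f ↔ mem (pair x y) g) : f = g := by
  refine IsModel.extensionality _ _ fun p => ⟨fun hp => ?_, fun hp => ?_⟩
  · obtain ⟨x, y, -, -, rfl⟩ := hf.1 p hp
    exact (h x y).1 hp
  · obtain ⟨x, y, -, -, rfl⟩ := hg.1 p hp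
    exact (h x y).2 hp

theorem exists_idGraph (A : M) :
    ∃ g : M, ∀ p : M, mem p g ↔ ∃ x : M, mem x A ∧ p = pair x x := by
  obtain ⟨y, hy⟩ := IsModel.comprehension (M := M)
    ((fMem top (lift (.inl 0)) ⊓ fPair (lift (.inr 0)) top top).ex) (fun _ => 1) (fun _ => 2)
    (by
      rw [strat_ex]
      refine ⟨0, ?_⟩
      rw [strat_inf]
      exact ⟨by simp [strat_mem], strat_pair (by simp) (by simp)⟩) (fun _ => A)
  exact ⟨y, fun z => by
    simp only [hy z,
      FirstOrder.Language.BoundedFormula.realize_ex,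
      FirstOrder.Language.BoundedFormula.realize_inf, realize_mem, realize_pair,
      elim_snoc_lift, elim_snoc_top]
    rfl⟩

/-- The graph `{⟨x, x⟩ | x ∈ A}` of the identity function. -/
noncomputable def idGraph (A : M) : M := (exists_idGraph A).choose

theorem mem_idGraph {A p : M} : mem p (idGraph A) ↔ ∃ x : M, mem x A ∧ p = pair x x :=
  (exists_idGraph A).choose_spec p

theorem pair_mem_idGraph {A x y : M} : mem (pair x y) (idGraph A) ↔ mem x A ∧ x = y := by
  rw [mem_idGraph]
  constructor
  · rintro ⟨z, hz, e⟩
    obtain ⟨rfl, rfl⟩ := pair_injective e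
    exact ⟨hz, rfl⟩
  · rintro ⟨hx, rfl⟩
    exact ⟨x, hx, rfl⟩

theorem isFun_idGraph (A : M) : IsFun (idGraph A) A A := by
  constructor
  · intro p hp
    obtain ⟨x, hx, e⟩ := mem_idGraph.1 hp
    exact ⟨x, x, hx, hx, e⟩
  · intro x hx
    exact ⟨x, pair_mem_idGraph.2 ⟨hx, rfl⟩, fun y hy => (pair_mem_idGraph.1 hy).2.symm⟩

theorem exists_compGraph (f g : M) :
    ∃ h : M, ∀ p : M, mem p h ↔
      ∃ x y z : M, mem (pair x y) f ∧ mem (pair y z) g ∧ p = pair x z := by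
  obtain ⟨h, hh⟩ := IsModel.comprehension (M := M)
    ((((fPairMem (lift (lift top)) (lift top) (lift (lift (lift (.inl 0)))) ⊓
      (fPairMem (lift top) top (lift (lift (lift (.inl 1)))) ⊓
        fPair (lift (lift (lift (.inr 0)))) (lift (lift top)) top)).ex).ex).ex)
    (fun _ => 3) (fun _ => 2)
    (by
      rw [strat_ex]
      refine ⟨0, ?_⟩
      rw [strat_ex]
      refine ⟨0, ?_⟩
      rw [strat_ex]
      refine ⟨0, ?_⟩
      rw [strat_inf, strat_inf]
      exact ⟨strat_pairMem (by simp) (by simp), strat_pairMem (by simp) (by simp),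
        strat_pair (by simp) (by simp)⟩) (fun k => if k = 0 then f else g)
  exact ⟨h, fun p => by
    simp only [hh p,
      FirstOrder.Language.BoundedFormula.realize_ex,
      FirstOrder.Language.BoundedFormula.realize_inf, realize_pairMem, realize_pair,
      elim_snoc_lift, elim_snoc_top]
    rfl⟩

/-- The graph `{⟨x, z⟩ | ∃ y, ⟨x, y⟩ ∈ f ∧ ⟨y, z⟩ ∈ g}` of the composite "first `f`, then `g`". -/
noncomputable def compGraph (f g : M) : M := (exists_compGraph f g).choose

theorem mem_compGraph {f g p : M} : mem p (compGraph f g) ↔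
    ∃ x y z : M, mem (pair x y) f ∧ mem (pair y z) g ∧ p = pair x z :=
  (exists_compGraph f g).choose_spec p

theorem pair_mem_compGraph {f g x z : M} : mem (pair x z) (compGraph f g) ↔
    ∃ y : M, mem (pair x y) f ∧ mem (pair y z) g := by
  rw [mem_compGraph]
  constructor
  · rintro ⟨x', y, z', h1, h2, e⟩
    obtain ⟨rfl, rfl⟩ := pair_injective e
    exact ⟨y, h1, h2⟩
  · rintro ⟨y, h1, h2⟩
    exact ⟨x, y, z, h1, h2, rfl⟩

theorem isFun_compGraph {f g A B C : M} (hf : IsFun f A B) (hg : IsFun g B C) :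
    IsFun (compGraph f g) A C := by
  constructor
  · intro p hp
    obtain ⟨x, y, z, h1, h2, e⟩ := mem_compGraph.1 hp
    exact ⟨x, z, (hf.mem_of_pair h1).1, (hg.mem_of_pair h2).2, e⟩
  · intro x hx
    obtain ⟨y, hy, uy⟩ := hf.2 x hx
    obtain ⟨z, hz, uz⟩ := hg.2 y (hf.mem_of_pair hy).2
    refine ⟨z, pair_mem_compGraph.2 ⟨y, hy, hz⟩, fun z' hz' => ?_⟩
    obtain ⟨y', h1, h2⟩ := pair_mem_compGraph.1 hz'
    obtain rfl := uy y' h1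
    exact uz z' h2

theorem exists_uscGraph (f : M) :
    ∃ h : M, ∀ p : M, mem p h ↔ ∃ a b : M, mem (pair a b) f ∧ p = pair (sing a) (sing b) := by
  obtain ⟨h, hh⟩ := IsModel.comprehension (M := M)
    (((((fPairMem (lift (lift (lift top))) (lift (lift top))
        (lift (lift (lift (lift (.inl 0))))) ⊓
      (fUpair (lift top) (lift (lift (lift top))) (lift (lift (lift top))) ⊓
        (fUpair top (lift (lift top)) (lift (lift top)) ⊓
          fPair (lift (lift (lift (lift (.inr 0))))) (lift top) top))).ex).ex).ex).ex)
    (fun _ => 3) (fun _ => 3)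
    (by
      rw [strat_ex]
      refine ⟨0, ?_⟩
      rw [strat_ex]
      refine ⟨0, ?_⟩
      rw [strat_ex]
      refine ⟨1, ?_⟩
      rw [strat_ex]
      refine ⟨1, ?_⟩
      rw [strat_inf, strat_inf, strat_inf]
      exact ⟨strat_pairMem (by simp) (by simp), strat_upair (by simp) (by simp),
        strat_upair (by simp) (by simp), strat_pair (by simp) (by simp)⟩) (fun _ => f)
  exact ⟨h, fun p => by
    simp only [hh p,
      FirstOrder.Language.BoundedFormula.realize_ex,
      FirstOrder.Language.BoundedFormula.realize_inf, realize_pairMem, realize_pair, realize_upair,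
      elim_snoc_lift, elim_snoc_top]
    simp only [Sum.elim_inl, Sum.elim_inr, sing]
    constructor
    · rintro ⟨a, b, _, _, h1, rfl, rfl, h2⟩
      exact ⟨a, b, h1, h2⟩
    · rintro ⟨a, b, h1, h2⟩
      exact ⟨a, b, _, _, h1, rfl, rfl, h2⟩⟩

/-- The graph `{⟨{a}, {b}⟩ | ⟨a, b⟩ ∈ f}`. -/
noncomputable def uscGraph (f : M) : M := (exists_uscGraph f).choose

theorem mem_uscGraph {f p : M} : mem p (uscGraph f) ↔
    ∃ a b : M, mem (pair a b) f ∧ p = pair (sing a) (sing b) :=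
  (exists_uscGraph f).choose_spec p

theorem pair_mem_uscGraph {f x y : M} : mem (pair x y) (uscGraph f) ↔
    ∃ a b : M, mem (pair a b) f ∧ x = sing a ∧ y = sing b := by
  rw [mem_uscGraph]
  constructor
  · rintro ⟨a, b, h, e⟩
    exact ⟨a, b, h, pair_injective e⟩
  · rintro ⟨a, b, h, rfl, rfl⟩
    exact ⟨a, b, h, rfl⟩

theorem isFun_uscGraph {f A B : M} (hf : IsFun f A B) : IsFun (uscGraph f) (usc A) (usc B) := by
  constructor
  · intro p hp
    obtain ⟨a, b, h, e⟩ := mem_uscGraph.1 hp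
    obtain ⟨ha, hb⟩ := hf.mem_of_pair h
    exact ⟨sing a, sing b, mem_usc.2 ⟨a, ha, rfl⟩, mem_usc.2 ⟨b, hb, rfl⟩, e⟩
  · intro x hx
    obtain ⟨a, ha, rfl⟩ := mem_usc.1 hx
    obtain ⟨b, hb, ub⟩ := hf.2 a ha
    refine ⟨sing b, pair_mem_uscGraph.2 ⟨a, b, hb, rfl, rfl⟩, fun y hy => ?_⟩
    obtain ⟨a', b', h, e, rfl⟩ := pair_mem_uscGraph.1 hy
    obtain rfl := sing_injective e
    rw [ub b' h]

end Sets

/-! ## The category of NF sets and the `T`-functor -/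

/-- The objects of the category of sets of a model `M` of NF: the elements of `M`. -/
@[ext] structure Obj (M : Type u) where
  /-- The underlying set of the model. -/
  set : M

/-- The morphisms `A ⟶ B`: the sets of the model that are functions from `A` to `B`. -/
@[ext] structure Hom {M : Type u} [setLang.Structure M] [IsModel M] (A B : Obj M) where
  /-- The graph of the function, a set of the model. -/
  graph : M
  isFun : IsFun graph A.set B.set

variable (M : Type u) [setLang.Structure M] [IsModel M]

/-- The category of sets and functions of a model `M` of NF. -/
noncomputable instance category : Category.{u, u} (Obj M) where
  Hom A B := Hom A B
  id A := ⟨idGraph A.set, isFun_idGraph A.set⟩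
  comp f g := ⟨compGraph f.graph g.graph, isFun_compGraph f.isFun g.isFun⟩
  id_comp {A B} f := by
    refine Hom.ext (IsFun.ext (isFun_compGraph (isFun_idGraph _) f.isFun) f.isFun fun x y => ?_)
    rw [pair_mem_compGraph]
    constructor
    · rintro ⟨z, h1, h2⟩
      obtain ⟨-, rfl⟩ := pair_mem_idGraph.1 h1
      exact h2
    · intro h
      exact ⟨x, pair_mem_idGraph.2 ⟨(f.isFun.mem_of_pair h).1, rfl⟩, h⟩
  comp_id {A B} f := by
    refine Hom.ext (IsFun.ext (isFun_compGraph f.isFun (isFun_idGraph _)) f.isFun fun x y => ?_)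
    rw [pair_mem_compGraph]
    constructor
    · rintro ⟨z, h1, h2⟩
      obtain ⟨-, rfl⟩ := pair_mem_idGraph.1 h2
      exact h1
    · intro h
      exact ⟨y, h, pair_mem_idGraph.2 ⟨(f.isFun.mem_of_pair h).2, rfl⟩⟩
  assoc {A B C D} f g h := by
    refine Hom.ext (IsFun.ext
      (isFun_compGraph (isFun_compGraph f.isFun g.isFun) h.isFun)
      (isFun_compGraph f.isFun (isFun_compGraph g.isFun h.isFun)) fun x y => ?_)
    simp only [pair_mem_compGraph]
    constructor
    · rintro ⟨z, ⟨w, h1, h2⟩, h3⟩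
      exact ⟨w, h1, z, h2, h3⟩
    · rintro ⟨w, h1, z, h2, h3⟩
      exact ⟨z, ⟨w, h1, h2⟩, h3⟩

/-- The `T`-functor: `A ↦ ι``A` on objects, `f ↦ {⟨{a}, {b}⟩ | ⟨a, b⟩ ∈ f}` on morphisms. -/
noncomputable def T : Obj M ⥤ Obj M where
  obj A := ⟨usc A.set⟩
  map f := ⟨uscGraph f.graph, isFun_uscGraph f.isFun⟩
  map_id A := by
    refine Hom.ext (IsFun.ext (isFun_uscGraph (isFun_idGraph A.set))
      (isFun_idGraph (usc A.set)) fun x y => ?_)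
    refine pair_mem_uscGraph.trans (Iff.trans ?_ pair_mem_idGraph.symm)
    rw [mem_usc]
    constructor
    · rintro ⟨a, b, h, rfl, rfl⟩
      obtain ⟨ha, rfl⟩ := pair_mem_idGraph.1 h
      exact ⟨⟨a, ha, rfl⟩, rfl⟩
    · rintro ⟨⟨a, ha, rfl⟩, rfl⟩
      exact ⟨a, a, pair_mem_idGraph.2 ⟨ha, rfl⟩, rfl, rfl⟩
  map_comp {A B C} f g := by
    refine Hom.ext (IsFun.ext (isFun_uscGraph (isFun_compGraph f.isFun g.isFun))
      (isFun_compGraph (isFun_uscGraph f.isFun) (isFun_uscGraph g.isFun)) fun x y => ?_)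
    refine pair_mem_uscGraph.trans (Iff.trans ?_ pair_mem_compGraph.symm)
    constructor
    · rintro ⟨a, c, h, rfl, rfl⟩
      obtain ⟨b, h1, h2⟩ := pair_mem_compGraph.1 h
      exact ⟨sing b, pair_mem_uscGraph.2 ⟨a, b, h1, rfl, rfl⟩,
        pair_mem_uscGraph.2 ⟨b, c, h2, rfl, rfl⟩⟩
    · rintro ⟨z, h1, h2⟩
      obtain ⟨a, b, h1', rfl, rfl⟩ := pair_mem_uscGraph.1 h1
      obtain ⟨b', c, h2', e, rfl⟩ := pair_mem_uscGraph.1 h2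
      obtain rfl := sing_injective e
      exact ⟨a, c, pair_mem_compGraph.2 ⟨b, h1', h2'⟩, rfl, rfl⟩

end NF

namespace NF

/-! ### Cantor's theorem for sets of singletons -/

section Cantor

variable {M : Type u} [setLang.Structure M] [IsModel M]

/-! In NF the universe `V` is its own power set, and Cantor's diagonal argument stays stratified
when it compares subsets with singletons `{a}` instead of elements `a`. Hence, for every `B`, no
function from `V` to `ι``B` is injective (`exists_not_injective_usc`) and no function from `ι``B` to
`V` is onto (`exists_not_mem_range_usc`).

If `L ⊣ T`, every map `V ⟶ TV` factors through the unit `V ⟶ TLV`. The unit identifies two points,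
which some two-valued map separates. Dually, if `T ⊣ R`, every map `TV ⟶ V` factors through the
counit `TRV ⟶ V`, which misses some `b`; the constant map `b` cannot factor.

If `T` is isomorphic to `GF` or `FG` with `F ⊣ G`, the unit or counit yields a natural
transformation `1 ⟶ T` or `T ⟶ 1`. Naturality along `{x} ⟶ V` forces its component at `V` to be `x ↦
{x}` or `{x} ↦ x`, again contrary to Cantor. -/

theorem IsFun.eq_of_pair {f A B x y z : M} (h : IsFun f A B) (hy : mem (pair x y) f)
    (hz : mem (pair x z) f) : y = z :=
  (h.2 x (h.mem_of_pair hy).1).unique hy hz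

variable (M) in
theorem exists_univ : ∃ V : M, ∀ z : M, mem z V := by
  obtain ⟨V, hV⟩ := IsModel.comprehension (M := M)
    (fEq (.inr 0) (.inr 0)) (fun _ => 0) (fun _ => 0) rfl
    -- The formula has no parameters, but an assignment is still required; this is where
    -- nonemptiness of the model enters.
    (fun _ => (IsModel.nonempty (M := M)).some)
  exact ⟨V, fun z => (hV z).2 rfl⟩

variable (M) in
theorem exists_empty : ∃ e : M, ∀ z : M, ¬ mem z e := by
  obtain ⟨e, he⟩ := IsModel.comprehension (M := M)
    (fEq (.inr 0) (.inr 0)).not (fun _ => 0) (fun _ => 0) (strat_not.2 (strat_eq.2 rfl))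
    (fun _ => (IsModel.nonempty (M := M)).some)
  exact ⟨e, fun z hz => (he z).1 hz rfl⟩

variable (M) in
theorem exists_ne : ∃ a b : M, a ≠ b := by
  obtain ⟨V, hV⟩ := exists_univ M
  obtain ⟨e, he⟩ := exists_empty M
  exact ⟨V, e, fun h => he e (h ▸ hV e)⟩

/-- The function on `A` sending `x` to `c` and everything else to `d` is a set of the model. -/
theorem exists_iteGraph (A x c d : M) : ∃ h : M, ∀ p : M, mem p h ↔
    ∃ z w : M, mem z A ∧ (z = x ∧ w = c ∨ z ≠ x ∧ w = d) ∧ p = pair z w := by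
  obtain ⟨h, hh⟩ := IsModel.comprehension (M := M)
    (((fMem (lift top) (lift (lift (.inl 0))) ⊓
      (((fEq (lift top) (lift (lift (.inl 1))) ⊓ fEq top (lift (lift (.inl 2)))) ⊔
        ((fEq (lift top) (lift (lift (.inl 1)))).not ⊓ fEq top (lift (lift (.inl 3))))) ⊓
        fPair (lift (lift (.inr 0))) (lift top) top)).ex).ex)
    -- Parameter 0 is `A`, one type above its elements; `x`, `c`, `d` have the type of the elements.
    -- The bound variable is a pair, two types above its components.
    (fun k => if k = 0 then 1 else 0) (fun _ => 2)
    (by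
      rw [strat_ex]
      refine ⟨0, ?_⟩
      rw [strat_ex]
      refine ⟨0, ?_⟩
      rw [strat_inf, strat_inf, strat_sup, strat_inf, strat_inf, strat_not]
      refine ⟨?_, ⟨⟨?_, ?_⟩, ?_, ?_⟩, strat_pair (by simp) (by simp)⟩ <;>
        simp [strat_mem, strat_eq])
    (fun k => if k = 0 then A else if k = 1 then x else if k = 2 then c else d)
  exact ⟨h, fun p => by
    simp only [hh p,
      FirstOrder.Language.BoundedFormula.realize_ex,
      FirstOrder.Language.BoundedFormula.realize_inf,
      FirstOrder.Language.BoundedFormula.realize_sup,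
      FirstOrder.Language.BoundedFormula.realize_not, realize_mem, realize_eq, realize_pair,
      elim_snoc_lift, elim_snoc_top]
    rfl⟩

theorem exists_ite_isFun {A B c d : M} (x : M) (hc : mem c B) (hd : mem d B) :
    ∃ h : M, IsFun h A B ∧ ∀ z w : M, mem (pair z w) h ↔
      mem z A ∧ (z = x ∧ w = c ∨ z ≠ x ∧ w = d) := by
  obtain ⟨h, hh⟩ := exists_iteGraph A x c d
  have key : ∀ z w : M, mem (pair z w) h ↔ mem z A ∧ (z = x ∧ w = c ∨ z ≠ x ∧ w = d) := by
    intro z w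
    rw [hh]
    constructor
    · rintro ⟨z', w', h1, h2, e⟩
      obtain ⟨rfl, rfl⟩ := pair_injective e
      exact ⟨h1, h2⟩
    · rintro ⟨h1, h2⟩
      exact ⟨z, w, h1, h2, rfl⟩
  refine ⟨h, ⟨fun p hp => ?_, fun z hz => ?_⟩, key⟩
  · obtain ⟨z, w, hz, hw, rfl⟩ := (hh p).1 hp
    refine ⟨z, w, hz, ?_, rfl⟩
    rcases hw with ⟨-, rfl⟩ | ⟨-, rfl⟩ <;> assumption
  · by_cases e : z = x
    · exact ⟨c, (key z c).2 ⟨hz, Or.inl ⟨e, rfl⟩⟩, fun w hw => by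
        rcases ((key z w).1 hw).2 with h' | h'
        exacts [h'.2, absurd e h'.1]⟩
    · exact ⟨d, (key z d).2 ⟨hz, Or.inr ⟨e, rfl⟩⟩, fun w hw => by
        rcases ((key z w).1 hw).2 with h' | h'
        exacts [absurd h'.1 e, h'.2]⟩

theorem exists_const_isFun {A B b : M} (hb : mem b B) :
    ∃ h : M, IsFun h A B ∧ ∀ z w : M, mem (pair z w) h ↔ mem z A ∧ w = b := by
  -- Both values are `b`, so the distinguished point plays no role.
  obtain ⟨h, hf, hh⟩ := exists_ite_isFun (A := A) b hb hb
  refine ⟨h, hf, fun z w => ?_⟩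
  rw [hh]
  tauto

/-- Cantor's theorem: the universe, being its own power set, does not inject into a set of
singletons. -/
theorem exists_not_injective_usc {f V B : M} (hV : ∀ z : M, mem z V) (hf : IsFun f V (usc B)) :
    ∃ x y w : M, x ≠ y ∧ mem (pair x w) f ∧ mem (pair y w) f := by
  by_contra hcon
  -- The diagonal set `D = {a | ∃ x, f(x) = {a} ∧ a ∉ x}`. It is stratified because values of `f`
  -- are singletons: `a` has type 0, `x` and `{a}` have type 1, and `f` has type 4.
  obtain ⟨D, hD⟩ := IsModel.comprehension (M := M)
    (((fUpair top (lift (lift (.inr 0))) (lift (lift (.inr 0))) ⊓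
      (fPairMem (lift top) top (lift (lift (.inl 0))) ⊓
        (fMem (lift (lift (.inr 0))) (lift top)).not)).ex).ex)
    (fun _ => 4) (fun _ => 0)
    (by
      rw [strat_ex]
      refine ⟨1, ?_⟩
      rw [strat_ex]
      refine ⟨1, ?_⟩
      rw [strat_inf, strat_inf, strat_not]
      exact ⟨strat_upair (by simp) (by simp), strat_pairMem (by simp) (by simp),
        by simp [strat_mem]⟩) (fun _ => f)
  replace hD : ∀ a : M, mem a D ↔ ∃ x s : M, s = sing a ∧ mem (pair x s) f ∧ ¬ mem a x := by
    intro a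
    simp only [hD a,
      FirstOrder.Language.BoundedFormula.realize_ex,
      FirstOrder.Language.BoundedFormula.realize_inf,
      FirstOrder.Language.BoundedFormula.realize_not, realize_mem, realize_upair,
      realize_pairMem, elim_snoc_lift, elim_snoc_top]
    rfl
  obtain ⟨w, hw, -⟩ := hf.2 D (hV D)
  obtain ⟨a, -, rfl⟩ := mem_usc.1 (hf.mem_of_pair hw).2
  -- With `f(D) = {a}`: a witness `x` for `a ∈ D` has `a ∉ x`, so it differs from `D` but has the
  -- same image, a collision.
  have hna : ¬ mem a D := by
    intro ha
    obtain ⟨x, s, rfl, hx, hax⟩ := (hD a).1 ha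
    exact hcon ⟨x, D, sing a, fun e => hax (e ▸ ha), hx, hw⟩
  exact hna ((hD a).2 ⟨D, _, rfl, hw, hna⟩)

/-- Cantor's theorem: no set of singletons maps onto the universe, which is its own power set. -/
theorem exists_not_mem_range_usc {f V B : M} (hf : IsFun f (usc B) V) :
    ∃ y : M, ∀ x : M, ¬ mem (pair x y) f := by
  by_contra! hcon
  -- The same diagonal with arguments and values exchanged: `D = {a | a ∉ f({a})}`.
  -- Single-valuedness of `f` now replaces injectivity.
  obtain ⟨D, hD⟩ := IsModel.comprehension (M := M)
    (((fUpair top (lift (lift (.inr 0))) (lift (lift (.inr 0))) ⊓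
      (fPairMem top (lift top) (lift (lift (.inl 0))) ⊓
        (fMem (lift (lift (.inr 0))) (lift top)).not)).ex).ex)
    (fun _ => 4) (fun _ => 0)
    (by
      rw [strat_ex]
      refine ⟨1, ?_⟩
      rw [strat_ex]
      refine ⟨1, ?_⟩
      rw [strat_inf, strat_inf, strat_not]
      exact ⟨strat_upair (by simp) (by simp), strat_pairMem (by simp) (by simp),
        by simp [strat_mem]⟩) (fun _ => f)
  replace hD : ∀ a : M, mem a D ↔ ∃ x s : M, s = sing a ∧ mem (pair s x) f ∧ ¬ mem a x := by
    intro a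
    simp only [hD a,
      FirstOrder.Language.BoundedFormula.realize_ex,
      FirstOrder.Language.BoundedFormula.realize_inf,
      FirstOrder.Language.BoundedFormula.realize_not, realize_mem, realize_upair,
      realize_pairMem, elim_snoc_lift, elim_snoc_top]
    rfl
  obtain ⟨w, hw⟩ := hcon D
  obtain ⟨a, -, rfl⟩ := mem_usc.1 (hf.mem_of_pair hw).1
  have hna : ¬ mem a D := by
    intro ha
    obtain ⟨x, s, rfl, hx, hax⟩ := (hD a).1 ha
    exact hax (hf.eq_of_pair hw hx ▸ ha)
  exact hna ((hD a).2 ⟨D, _, rfl, hw, hna⟩)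

end Cantor

/-! ### Units, counits and natural transformations -/

section Adjoint

variable (M : Type u) [setLang.Structure M] [IsModel M]

-- Serves to trace elements through factorizations and naturality squares.
variable {M} in
theorem pair_mem_comp {A B C : Obj M} {f : A ⟶ B} {g : B ⟶ C} {h : A ⟶ C} (e : f ≫ g = h)
    {x z : M} : mem (pair x z) h.graph ↔
      ∃ y : M, mem (pair x y) f.graph ∧ mem (pair y z) g.graph := by
  subst e
  exact pair_mem_compGraph

theorem not_isRightAdjoint_T : ¬ (T M).IsRightAdjoint := by
  intro h
  obtain ⟨V, hV⟩ := exists_univ M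
  obtain ⟨c, d, hcd⟩ := exists_ne M
  let adj := Adjunction.ofIsRightAdjoint (T M)
  let η : (⟨V⟩ : Obj M) ⟶ (T M).obj ((T M).leftAdjoint.obj ⟨V⟩) := adj.unit.app ⟨V⟩
  obtain ⟨x, y, w, hxy, hx, hy⟩ := exists_not_injective_usc hV η.isFun
  -- A map separating `x` from `y`, the points identified by the unit.
  obtain ⟨g, hg, hgm⟩ := exists_ite_isFun (A := V) (B := usc V) x
    (mem_usc.2 ⟨c, hV c, rfl⟩) (mem_usc.2 ⟨d, hV d, rfl⟩)
  let γ : (⟨V⟩ : Obj M) ⟶ (T M).obj ⟨V⟩ := ⟨g, hg⟩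
  have e : η ≫ (T M).map ((adj.homEquiv _ _).symm γ) = γ :=
    (adj.homEquiv_unit ..).symm.trans ((adj.homEquiv _ _).apply_symm_apply γ)
  -- The second factor sends `w = η(x) = η(y)` to `{c}`, so `γ(y) = {c}` too.
  obtain ⟨w', h1, h2⟩ := (pair_mem_comp e).1 ((hgm x (sing c)).2 ⟨hV x, Or.inl ⟨rfl, rfl⟩⟩)
  obtain rfl := η.isFun.eq_of_pair hx h1
  rcases ((hgm y (sing c)).1 ((pair_mem_comp e).2 ⟨w, hy, h2⟩)).2 with h' | h'
  · exact hxy h'.1.symm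
  · exact hcd (sing_injective h'.2)

theorem not_isLeftAdjoint_T : ¬ (T M).IsLeftAdjoint := by
  intro h
  obtain ⟨V, hV⟩ := exists_univ M
  let adj := Adjunction.ofIsLeftAdjoint (T M)
  let ε : (T M).obj ((T M).rightAdjoint.obj ⟨V⟩) ⟶ (⟨V⟩ : Obj M) := adj.counit.app ⟨V⟩
  obtain ⟨b, hb⟩ := exists_not_mem_range_usc ε.isFun
  obtain ⟨g, hg, hgm⟩ := exists_const_isFun (A := usc V) (hV b)
  let γ : (T M).obj ⟨V⟩ ⟶ (⟨V⟩ : Obj M) := ⟨g, hg⟩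
  have e : (T M).map ((adj.homEquiv _ _) γ) ≫ ε = γ :=
    (adj.homEquiv_counit ..).symm.trans ((adj.homEquiv _ _).symm_apply_apply γ)
  -- `TV` is nonempty, as `{b}` belongs to it; evaluating the factorization there puts `b` in the
  -- range of `ε`.
  obtain ⟨m, -, hm⟩ := (pair_mem_comp e).1 ((hgm (sing b) b).2 ⟨mem_usc.2 ⟨b, hV b, rfl⟩, rfl⟩)
  exact hb m hm

theorem isEmpty_id_hom_T : IsEmpty (𝟭 (Obj M) ⟶ T M) := by
  refine ⟨fun η => ?_⟩
  obtain ⟨V, hV⟩ := exists_univ M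
  have key : ∀ x w : M, mem (pair x w) (η.app ⟨V⟩).graph → w = sing x := by
    intro x w hw
    -- On `{x}` the constant map `x` is the inclusion into `V`. By naturality `η` at `V` sends `x`
    -- into the image of `Tι`, whose only element is `{x}`.
    obtain ⟨i, hi, him⟩ := exists_const_isFun (A := sing x) (hV x)
    let ι : (⟨sing x⟩ : Obj M) ⟶ ⟨V⟩ := ⟨i, hi⟩
    obtain ⟨m, -, hm⟩ := (pair_mem_comp (η.naturality ι).symm).1
      ((pair_mem_comp rfl).2 ⟨x, (him x x).2 ⟨mem_sing.2 rfl, rfl⟩, hw⟩)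
    obtain ⟨a, b, hab, -, rfl⟩ := pair_mem_uscGraph.1 hm
    rw [((him a b).1 hab).2]
  obtain ⟨x, y, w, hxy, hx, hy⟩ := exists_not_injective_usc hV (η.app ⟨V⟩).isFun
  exact hxy (sing_injective ((key x w hx).symm.trans (key y w hy)))

theorem isEmpty_T_hom_id : IsEmpty (T M ⟶ 𝟭 (Obj M)) := by
  refine ⟨fun ε => ?_⟩
  obtain ⟨V, hV⟩ := exists_univ M
  obtain ⟨b, hb⟩ := exists_not_mem_range_usc (ε.app ⟨V⟩).isFun
  obtain ⟨i, hi, him⟩ := exists_const_isFun (A := sing b) (hV b)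
  let ι : (⟨sing b⟩ : Obj M) ⟶ ⟨V⟩ := ⟨i, hi⟩
  obtain ⟨y, hy, -⟩ := (ε.app ⟨sing b⟩).isFun.2 (sing b) (mem_usc.2 ⟨b, mem_sing.2 rfl, rfl⟩)
  have hyb : mem y (sing b) := ((ε.app ⟨sing b⟩).isFun.mem_of_pair hy).2
  -- One way round the square, `{b}` goes to `y` and then to `b`; the other way ends with `ε` at
  -- `V`, so `b` lies in its range.
  obtain ⟨m, -, hm⟩ := (pair_mem_comp (ε.naturality ι)).1
    ((pair_mem_comp rfl).2 ⟨y, hy, (him y b).2 ⟨hyb, rfl⟩⟩)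
  exact hb m hm

end Adjoint

end NF

/-- For every model `M` of NF, the functor `T` on its category of sets is neither a right adjoint
nor a left adjoint, and it is not (even up to natural isomorphism) of the form `G ∘ F` or `F ∘ G`
for an adjoint pair `F ⊣ G`. -/
theorem mainTheorem7 (M : Type u) [NF.setLang.Structure M] [NF.IsModel M] :
    ¬ (NF.T M).IsRightAdjoint ∧
    ¬ (NF.T M).IsLeftAdjoint ∧
    (∀ (D : Type w) [Category.{v} D] (F : NF.Obj M ⥤ D) (G : D ⥤ NF.Obj M),
      (F ⊣ G) → IsEmpty (NF.T M ≅ F ⋙ G)) ∧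
    (∀ (D : Type w) [Category.{v} D] (F : D ⥤ NF.Obj M) (G : NF.Obj M ⥤ D),
      (F ⊣ G) → IsEmpty (NF.T M ≅ G ⋙ F)) :=
  ⟨NF.not_isRightAdjoint_T M, NF.not_isLeftAdjoint_T M,
    fun _ _ _ _ adj => ⟨fun e => (NF.isEmpty_id_hom_T M).false (adj.unit ≫ e.inv)⟩,
    fun _ _ _ _ adj => ⟨fun e => (NF.isEmpty_T_hom_id M).false (e.hom ≫ adj.counit)⟩⟩
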